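/- Let $a_0, a_1, a_2, \dots$ be independent complex normal random variables with mean zero and variances $\sigma_i^2 \ge 0$, not all zero; that is, the real and imaginary parts of $a_i$ are independent real normals with mean zero and the same variance, and $\mathbb{E}|a_i|^2 = \sigma_i^2$. Let $$f(z) = \sum_{i \ge 0} a_i z^i, \qquad \phi(z) = \sum_{i \ge 0} \sigma_i^2 z^i,$$ and assume that $\phi$ has radius of convergence $R \in (0, \infty]$. Then almost surely the series $f(z)$ converges for every $z \in \mathbb{C}$ with $|z|^2 < R$, and for every $r > 0$ with $r^2 < R$ the expected number $n(r)$ of zeros of $f$ in the disk $|z| < r$, counted with multiplicity, is finite and equals $$n(r) = \frac{r}{2} \frac{d}{dr} \log \phi(r^2).$$ -/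

import Mathlib

open MeasureTheory ProbabilityTheory
open scoped NNReal ENNReal

/-- `X` is a complex normal random variable with mean zero and variance `v`: its real and imaginary
parts are independent and identically distributed central normals. The variance is
`v = E |X|²`, so each of the two parts has variance `v / 2` (for `v = 0`, `X = 0` almost surely). -/
structure IsComplexNormal {Ω : Type*} [MeasurableSpace Ω] (X : Ω → ℂ) (v : ℝ≥0)
    (P : Measure Ω) : Prop where
  law_re : HasLaw (fun ω => (X ω).re) (gaussianReal 0 (v / 2)) P
  law_im : HasLaw (fun ω => (X ω).im) (gaussianReal 0 (v / 2)) P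
  indep : IndepFun (fun ω => (X ω).re) (fun ω => (X ω).im) P

/-- The radius of convergence of the generating function `∑ σᵢ² zⁱ` of the variances. -/
noncomputable def varianceRadius (σ : ℕ → ℝ≥0) : ℝ≥0∞ :=
  (FormalMultilinearSeries.ofScalars ℝ (fun i => (σ i : ℝ) ^ 2)).radius

/-- The generating function `φ(x) = ∑ σᵢ² xⁱ` of the variances, at a real argument. -/
noncomputable def varianceGF (σ : ℕ → ℝ≥0) (x : ℝ) : ℝ :=
  ∑' i, (σ i : ℝ) ^ 2 * x ^ i

/-- The random power series `f(z) = ∑ aᵢ zⁱ`, at the sample point `ω`. -/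
noncomputable def randomSeries {Ω : Type*} (a : ℕ → Ω → ℂ) (ω : Ω) (z : ℂ) : ℂ :=
  ∑' i, a i ω * z ^ i

/-- The number of zeros in `S` of a function analytic on a neighbourhood of `S`, counted with
multiplicity. The order of vanishing `analyticOrderAt f z` is `0` where `f z ≠ 0`, and `⊤` where
`f` vanishes identically near `z`. -/
noncomputable def zeroCount (f : ℂ → ℂ) (S : Set ℂ) : ℝ≥0∞ :=
  ∑' z : S, (analyticOrderAt f (z : ℂ) : ℝ≥0∞)

/-! Let `A t` be the mean of `log |f|` over the circle `|z| = t` and `N t` the number of zeros in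
the open disk. Jensen's formula on two circles `s < t` gives `N s * log (t/s) ≤ A t - A s ≤ N t *
log (t/s)` almost surely (`zeroCount_mul_log_le_and_le`, `ae_zeroCount_sandwich`).

For fixed `z`, `f z` is a centred complex normal of variance `φ(|z|²)`, so `log |f z|` has
expectation `½ log φ(|z|²)` plus a universal constant. By Fubini `E[A t]` has the same value, and
the constant cancels in `E[A t] - E[A s]`.

Take expectations, divide by `log (t/s)` and let `t ↓ r` with `s = r`, or `s ↑ r` with `t = r`: both
bounds on `E[N r]` tend to the derivative of `½ log φ(r²)` with respect to `log r`
(`lintegral_eq_of_forall_mul_log_le`). Finiteness comes out of the same bound. -/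

/-! ### Jensen's formula and the zero count -/

/-- The contribution of a zero at `u` to Jensen's formula on the circle of radius `t`. -/
noncomputable def jensenWeight (t : ℝ) (u : ℂ) : ℝ :=
  if u = 0 then Real.log t else if ‖u‖ ≤ t then Real.log (t * ‖u‖⁻¹) else 0

theorem jensenWeight_sub_nonneg {s r : ℝ} (hs : 0 < s) (hsr : s < r) {u : ℂ} (hu : ‖u‖ ≤ r) :
    0 ≤ jensenWeight r u - jensenWeight s u := by
  unfold jensenWeight
  have hr := hs.trans hsr
  split_ifs with h0 h1
  · linarith [Real.log_lt_log hs hsr]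
  · have : 0 < ‖u‖⁻¹ := by positivity
    have := Real.log_lt_log (mul_pos hs this) (mul_lt_mul_of_pos_right hsr this)
    linarith
  · have : 0 < ‖u‖ := by positivity
    rw [sub_zero]
    refine Real.log_nonneg ?_
    rwa [← div_eq_mul_inv, one_le_div this]

theorem jensenWeight_sub_eq {s r : ℝ} (hs : 0 < s) (hsr : s < r) {u : ℂ} (hu : ‖u‖ ≤ s) :
    jensenWeight r u - jensenWeight s u = Real.log (r / s) := by
  unfold jensenWeight
  have hr := hs.trans hsr
  rw [Real.log_div hr.ne' hs.ne']
  split_ifs with h0 h1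
  · rfl
  · have : ‖u‖ ≠ 0 := by positivity
    rw [Real.log_mul hr.ne' (inv_ne_zero this), Real.log_mul hs.ne' (inv_ne_zero this)]
    ring
  · linarith

/-- For `s < ‖u‖ < r` the difference is `log (r / ‖u‖)`. On the circle `‖u‖ = r` it is `log 1 = 0`,
which is why zeros of the open disk alone suffice in the upper bound. -/
theorem jensenWeight_sub_le {s r : ℝ} (hs : 0 < s) (hsr : s < r) (u : ℂ) :
    jensenWeight r u - jensenWeight s u ≤ if ‖u‖ < r then Real.log (r / s) else 0 := by
  have hr := hs.trans hsr
  rcases le_or_gt ‖u‖ s with h | h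
  · rw [jensenWeight_sub_eq hs hsr h, if_pos (h.trans_lt hsr)]
  have hu : 0 < ‖u‖ := hs.trans h
  have h0 : u ≠ 0 := norm_pos_iff.1 hu
  unfold jensenWeight
  rw [if_neg h0, if_neg h0, if_neg h.not_ge, sub_zero]
  split_ifs with h1 h2 h2
  · rw [← div_eq_mul_inv]
    exact Real.log_le_log (by positivity) (by gcongr)
  · rw [le_antisymm h1 (not_lt.1 h2), mul_inv_cancel₀ hr.ne', Real.log_one]
  · exact absurd h2.le h1
  · rfl

-- One finite set `Z` serves every radius `t ≤ r`, so the formulas on two circles subtract term by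
-- term and the trailing coefficient, independent of `t`, cancels.
open Metric in
theorem circleAverage_log_norm_eq_sum_jensenWeight {f : ℂ → ℂ} {r t : ℝ} (ht : 0 < t) (htr : t ≤ r)
    (hf : AnalyticOnNhd ℂ f (closedBall 0 r))
    (hord : ∀ u ∈ closedBall (0 : ℂ) r, analyticOrderAt f u ≠ ⊤) {Z : Finset ℂ}
    (hZ : ∀ u ∈ closedBall (0 : ℂ) r, analyticOrderNatAt f u ≠ 0 → u ∈ Z) :
    Real.circleAverage (fun z => Real.log ‖f z‖) 0 t =
      ∑ u ∈ Z, (analyticOrderNatAt f u : ℝ) * jensenWeight t u +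
        Real.log ‖meromorphicTrailingCoeffAt f 0‖ := by
  have hsub : closedBall (0 : ℂ) t ⊆ closedBall 0 r := closedBall_subset_closedBall htr
  have hft : AnalyticOnNhd ℂ f (closedBall 0 |t|) := by
    rw [abs_of_pos ht]; exact hf.mono hsub
  have hdiv : ∀ u ∈ closedBall (0 : ℂ) t,
      (MeromorphicOn.divisor f (closedBall 0 t) u : ℝ) = analyticOrderNatAt f u := by
    intro u hu
    rw [MeromorphicOn.AnalyticOnNhd.divisor_apply (hf.mono hsub) hu, ← Nat.cast_analyticOrderNatAt (hord u (hsub hu))]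
    simp
  rw [MeromorphicOn.circleAverage_log_norm ht.ne' hft.meromorphicOn, abs_of_pos ht,
    hdiv 0 (by simp [ht.le])]
  congr 1
  rw [finsum_eq_sum_of_support_subset (s := Z)]
  · have h0 : (analyticOrderNatAt f 0 : ℝ) * Real.log t =
        ∑ u ∈ Z, if u = 0 then (analyticOrderNatAt f u : ℝ) * Real.log t else 0 := by
      rw [Finset.sum_ite_eq']
      split_ifs with h
      · rfl
      · have : analyticOrderNatAt f 0 = 0 := by
          by_contra hne
          exact h (hZ 0 (by simp [ht.le.trans htr]) hne)
        simp [this]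
    rw [h0, ← Finset.sum_add_distrib]
    refine Finset.sum_congr rfl fun u _ => ?_
    unfold jensenWeight
    split_ifs with h1 h2
    -- The divisor sum contributes nothing at the origin, because `‖0‖⁻¹ = 0` and `Real.log 0 = 0`;
    -- the separate `log t` term supplies the weight.
    · simp [h1]
    · rw [hdiv u (by simpa using h2)]; simp
    · rw [Function.locallyFinsuppWithin.apply_eq_zero_of_notMem]
      · simp
      · simpa using h2
  · intro u hu
    have hmem : u ∈ closedBall (0 : ℂ) t := by
      by_contra h
      apply hu
      simp only
      rw [Function.locallyFinsuppWithin.apply_eq_zero_of_notMem _ h]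
      simp
    refine hZ u (hsub hmem) fun h => hu ?_
    simp only
    rw [hdiv u hmem, h]
    simp

open Metric in
theorem finite_setOf_analyticOrderNatAt_ne_zero {f : ℂ → ℂ} {r : ℝ}
    (hf : AnalyticOnNhd ℂ f (closedBall 0 r))
    (hord : ∀ u ∈ closedBall (0 : ℂ) r, analyticOrderAt f u ≠ ⊤) :
    {u ∈ closedBall (0 : ℂ) r | analyticOrderNatAt f u ≠ 0}.Finite := by
  refine ((MeromorphicOn.divisor f (closedBall 0 r)).finiteSupport
    (isCompact_closedBall 0 r)).subset ?_
  rintro u ⟨hu, hne⟩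
  rw [Function.mem_support, MeromorphicOn.AnalyticOnNhd.divisor_apply hf hu, ← Nat.cast_analyticOrderNatAt (hord u hu)]
  simpa using hne

open Metric in
theorem zeroCount_ball_eq_sum {f : ℂ → ℂ} {r t : ℝ} (htr : t ≤ r)
    (hord : ∀ u ∈ closedBall (0 : ℂ) r, analyticOrderAt f u ≠ ⊤) {Z : Finset ℂ}
    (hZ : ∀ u ∈ closedBall (0 : ℂ) r, analyticOrderNatAt f u ≠ 0 → u ∈ Z) :
    zeroCount f (ball 0 t) =
      ENNReal.ofReal (∑ u ∈ Z, if ‖u‖ < t then (analyticOrderNatAt f u : ℝ) else 0) := by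
  have hsub : ball (0 : ℂ) t ⊆ closedBall 0 r :=
    ball_subset_closedBall.trans (closedBall_subset_closedBall htr)
  rw [ENNReal.ofReal_sum_of_nonneg fun u _ => by split_ifs <;> positivity, zeroCount,
    tsum_subtype (ball (0 : ℂ) t) fun z => (analyticOrderAt f z : ℝ≥0∞), tsum_eq_sum (s := Z)]
  · refine Finset.sum_congr rfl fun u _ => ?_
    split_ifs with h
    · rw [Set.indicator_of_mem (by simpa using h),
        ← Nat.cast_analyticOrderNatAt (hord u (hsub (by simpa using h)))]
      simp
    · rw [Set.indicator_of_notMem (by simpa using h)]; simp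
  · intro u hu
    rw [Set.indicator_apply_eq_zero]
    intro hmem
    have : analyticOrderNatAt f u = 0 := by
      by_contra h
      exact hu (hZ u (hsub hmem) h)
    rw [← Nat.cast_analyticOrderNatAt (hord u (hsub hmem)), this]
    simp

open Metric in
/-- Jensen's formula, compared on two circles. -/
theorem zeroCount_mul_log_le_and_le {f : ℂ → ℂ} {s r : ℝ} (hs : 0 < s) (hsr : s < r)
    (hf : AnalyticOnNhd ℂ f (closedBall 0 r))
    (hord : ∀ u ∈ closedBall (0 : ℂ) r, analyticOrderAt f u ≠ ⊤) :
    zeroCount f (ball 0 s) * ENNReal.ofReal (Real.log (r / s)) ≤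
        ENNReal.ofReal (Real.circleAverage (fun z => Real.log ‖f z‖) 0 r -
          Real.circleAverage (fun z => Real.log ‖f z‖) 0 s) ∧
      ENNReal.ofReal (Real.circleAverage (fun z => Real.log ‖f z‖) 0 r -
          Real.circleAverage (fun z => Real.log ‖f z‖) 0 s) ≤
        zeroCount f (ball 0 r) * ENNReal.ofReal (Real.log (r / s)) ∧
      0 ≤ Real.circleAverage (fun z => Real.log ‖f z‖) 0 r -
          Real.circleAverage (fun z => Real.log ‖f z‖) 0 s := by
  have hfin := finite_setOf_analyticOrderNatAt_ne_zero hf hord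
  have hZ : ∀ u ∈ closedBall (0 : ℂ) r, analyticOrderNatAt f u ≠ 0 → u ∈ hfin.toFinset :=
    fun u hu h => by rw [Set.Finite.mem_toFinset]; exact ⟨hu, h⟩
  have hlog : 0 ≤ Real.log (r / s) := Real.log_nonneg (by rw [one_le_div hs]; exact hsr.le)
  rw [zeroCount_ball_eq_sum le_rfl hord hZ, zeroCount_ball_eq_sum hsr.le hord hZ,
    circleAverage_log_norm_eq_sum_jensenWeight hs hsr.le hf hord hZ,
    circleAverage_log_norm_eq_sum_jensenWeight (hs.trans hsr) le_rfl hf hord hZ,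
    add_sub_add_right_eq_sub, ← Finset.sum_sub_distrib, ← ENNReal.ofReal_mul' hlog,
    ← ENNReal.ofReal_mul' hlog, Finset.sum_mul, Finset.sum_mul]
  simp_rw [← mul_sub]
  have hnn : ∀ u ∈ hfin.toFinset, 0 ≤ jensenWeight r u - jensenWeight s u := fun u hu => by
    rw [Set.Finite.mem_toFinset] at hu
    exact jensenWeight_sub_nonneg hs hsr (by simpa using hu.1)
  refine ⟨ENNReal.ofReal_le_ofReal (Finset.sum_le_sum fun u hu => ?_),
    ENNReal.ofReal_le_ofReal (Finset.sum_le_sum fun u hu => ?_),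
    Finset.sum_nonneg fun u hu => mul_nonneg (Nat.cast_nonneg _) (hnn u hu)⟩
  · split_ifs with h
    · rw [jensenWeight_sub_eq hs hsr h.le]
    · rw [zero_mul]; exact mul_nonneg (Nat.cast_nonneg _) (hnn u hu)
  · have := mul_le_mul_of_nonneg_left (jensenWeight_sub_le hs hsr u)
      (Nat.cast_nonneg (α := ℝ) (analyticOrderNatAt f u))
    split_ifs at this ⊢ <;> simpa using this

-- Every point of the open disk already lies in some smaller disk, and suprema commute with finite
-- sums of monotone families. Serves to prove measurability of the count.
open Metric Filter Topology in
theorem zeroCount_ball_le_iSup (f : ℂ → ℂ) {r : ℝ} {s : ℕ → ℝ} (hmono : Monotone s)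
    (hlim : Tendsto s atTop (𝓝 r)) :
    zeroCount f (ball 0 r) ≤ ⨆ k, zeroCount f (ball 0 (s k)) := by
  unfold zeroCount
  simp_rw [tsum_subtype _ fun z => (analyticOrderAt f z : ℝ≥0∞)]
  refine ENNReal.summable.tsum_le_of_sum_le fun F => ?_
  have hdir : ∀ z, (ball (0 : ℂ) r).indicator (fun z => (analyticOrderAt f z : ℝ≥0∞)) z ≤
      ⨆ k, (ball (0 : ℂ) (s k)).indicator (fun z => (analyticOrderAt f z : ℝ≥0∞)) z := by
    intro z
    by_cases hz : z ∈ ball (0 : ℂ) r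
    · obtain ⟨k, hk⟩ := (hlim.eventually_const_lt (mem_ball_zero_iff.1 hz)).exists
      refine le_iSup_of_le k ?_
      rw [Set.indicator_of_mem hz, Set.indicator_of_mem (mem_ball_zero_iff.2 hk)]
    · rw [Set.indicator_of_notMem hz]; exact zero_le
  refine (Finset.sum_le_sum fun z _ => hdir z).trans ?_
  rw [ENNReal.finsetSum_iSup_of_monotone]
  · exact iSup_mono fun k => ENNReal.sum_le_tsum F
  · intro z k l hkl
    exact Set.indicator_le_indicator_of_subset (ball_subset_ball (hmono hkl))
      (fun _ => zero_le) z

/-! ### Integrability of the logarithm under Gaussian measures -/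

theorem gaussianReal_zero_one_le_volume : gaussianReal 0 1 ≤ volume := by
  rw [gaussianReal_of_var_ne_zero 0 one_ne_zero]
  conv_rhs => rw [← withDensity_one (μ := (volume : Measure ℝ))]
  refine withDensity_mono (Filter.Eventually.of_forall fun x => ?_)
  rw [gaussianPDF, gaussianPDFReal, Pi.one_apply, ← ENNReal.ofReal_one]
  refine ENNReal.ofReal_le_ofReal ?_
  refine mul_le_one₀ ?_ (Real.exp_nonneg _) (Real.exp_le_one_iff.2 ?_)
  · refine inv_le_one_of_one_le₀ (Real.one_le_sqrt.2 ?_)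
    have := Real.pi_gt_three
    simp only [NNReal.coe_one]
    linarith
  · have := sq_nonneg (x - 0)
    rw [neg_div]
    exact neg_nonpos.2 (by positivity)

/-- Near `0` the Gaussian is dominated by Lebesgue measure, for which `log` is locally integrable;
away from it `|log x| ≤ |x|`. -/
theorem integrable_log_gaussianReal_zero_one : Integrable Real.log (gaussianReal 0 1) := by
  have h1 : Integrable (fun x : ℝ => ‖x‖) (gaussianReal 0 1) :=
    (IsGaussian.integrable_id (μ := gaussianReal 0 1)).norm
  have h2 : Integrable ((Set.uIoc (-1 : ℝ) 1).indicator Real.log) (gaussianReal 0 1) := by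
    refine Integrable.mono_measure ?_ gaussianReal_zero_one_le_volume
    rw [integrable_indicator_iff measurableSet_uIoc]
    exact intervalIntegrable_iff.1 intervalIntegral.intervalIntegrable_log'
  refine (h1.add h2.norm).mono' Real.measurable_log.aestronglyMeasurable
    (Filter.Eventually.of_forall fun x => ?_)
  rw [Pi.add_apply]
  by_cases hx : x ∈ Set.uIoc (-1 : ℝ) 1
  · rw [Set.indicator_of_mem hx]
    linarith [norm_nonneg x]
  · rw [Set.indicator_of_notMem hx, norm_zero, add_zero]
    rw [Set.uIoc_of_le (by norm_num), Set.mem_Ioc, not_and_or, not_lt, not_le] at hx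
    have h1 : 1 ≤ |x| := by
      rcases hx with hx | hx
      · exact le_abs.2 (Or.inr (by linarith))
      · exact le_abs.2 (Or.inl hx.le)
    rw [← Real.log_abs, Real.norm_eq_abs, Real.norm_eq_abs, abs_of_nonneg (Real.log_nonneg h1)]
    linarith [Real.log_le_sub_one_of_pos (zero_lt_one.trans_le h1)]

theorem measurable_log_norm : Measurable fun x : ℂ => Real.log ‖x‖ :=
  Real.measurable_log.comp measurable_norm

theorem stdGaussian_map_re : (stdGaussian ℂ).map Complex.re = gaussianReal 0 1 := by
  have h := IsGaussian.map_eq_gaussianReal (μ := stdGaussian ℂ) Complex.reCLM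
  rw [variance_dual_stdGaussian, integral_strongDual_stdGaussian, Complex.reCLM_norm] at h
  rw [show (Complex.re : ℂ → ℝ) = ⇑Complex.reCLM from rfl, h]
  simp

theorem ae_re_ne_zero_stdGaussian : ∀ᵐ x ∂(stdGaussian ℂ), x.re ≠ 0 := by
  have : ∀ᵐ y ∂((stdGaussian ℂ).map Complex.re), y ≠ 0 := by
    rw [stdGaussian_map_re]
    have := nullSingletonClass_gaussianReal (μ := 0) (v := 1) one_ne_zero
    exact Measure.ae_ne _ _
  exact ae_of_ae_map Complex.measurable_re.aemeasurable this

/-- For `‖x‖ ≤ 1`, `|Re x| ≤ ‖x‖` bounds `|log ‖x‖|` by `|log |Re x||`, reducing the singularity to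
the real case. -/
theorem integrable_log_norm_stdGaussian :
    Integrable (fun x : ℂ => Real.log ‖x‖) (stdGaussian ℂ) := by
  have h1 : Integrable (fun x : ℂ => ‖x‖) (stdGaussian ℂ) :=
    (IsGaussian.integrable_id (μ := stdGaussian ℂ)).norm
  have h2 : Integrable (fun x : ℂ => Real.log x.re) (stdGaussian ℂ) := by
    have := integrable_log_gaussianReal_zero_one
    rw [← stdGaussian_map_re] at this
    exact this.comp_measurable Complex.measurable_re
  refine (h1.add h2.norm).mono' measurable_log_norm.aestronglyMeasurable ?_
  filter_upwards [ae_re_ne_zero_stdGaussian] with x hx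
  have h0 : 0 < |x.re| := abs_pos.2 hx
  have hle := Complex.abs_re_le_norm x
  rw [Pi.add_apply, Real.norm_eq_abs, Real.norm_eq_abs, ← Real.log_abs x.re]
  rcases le_total 1 ‖x‖ with h | h
  · rw [abs_of_nonneg (Real.log_nonneg h)]
    linarith [Real.log_le_sub_one_of_pos (zero_lt_one.trans_le h), abs_nonneg (Real.log |x.re|)]
  · rw [abs_of_nonpos (Real.log_nonpos (norm_nonneg x) h),
      abs_of_nonpos (Real.log_nonpos h0.le (hle.trans h))]
    linarith [Real.log_le_log h0 hle, norm_nonneg x]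

/-! ### Laws of complex normals and of the series at a point -/

section

variable {Ω : Type*} [MeasurableSpace Ω] {P : Measure Ω}

/-- Each coordinate of the standard Gaussian on `ℂ` has variance `1`, so `E‖x‖² = 2`; hence the
scaling `√(v / 2)`. -/
theorem hasLaw_smul_stdGaussian [IsProbabilityMeasure P] {X : Ω → ℂ} {v : ℝ} (hv : 0 ≤ v) (hX : AEMeasurable X P)
    (hchar : ∀ t, charFun (P.map X) t = Complex.exp (-(v * ‖t‖ ^ 2 / 4 : ℝ))) :
    HasLaw X ((stdGaussian ℂ).map (fun x => √(v / 2) • x)) P := by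
  refine ⟨hX, ?_⟩
  have := Measure.isProbabilityMeasure_map hX
  refine Measure.ext_of_charFun ?_
  ext t
  rw [hchar, charFun_map_smul, charFun_stdGaussian, norm_smul, ← Complex.ofReal_pow,
    mul_pow, Real.norm_eq_abs, sq_abs, Real.sq_sqrt (by positivity)]
  congr 1
  push_cast
  ring

theorem IsComplexNormal.aemeasurable {X : Ω → ℂ} {v : ℝ≥0} (h : IsComplexNormal X v P) :
    AEMeasurable X P := by
  have h1 := h.law_re.aemeasurable
  have h2 := h.law_im.aemeasurable
  have : X = fun ω => ((X ω).re : ℂ) + (X ω).im * Complex.I := by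
    ext ω; exact (Complex.re_add_im _).symm
  rw [this]
  fun_prop

theorem IsComplexNormal.charFun_map [IsProbabilityMeasure P] {X : Ω → ℂ} {v : ℝ≥0} (h : IsComplexNormal X v P) (t : ℂ) :
    charFun (P.map X) t = Complex.exp (-(v * ‖t‖ ^ 2 / 4 : ℝ)) := by
  have h1 := h.law_re.aemeasurable
  have h2 := h.law_im.aemeasurable
  have hX : X = (fun ω => ((X ω).re : ℂ)) + fun ω => ((X ω).im : ℂ) * Complex.I := by
    ext ω; exact (Complex.re_add_im _).symm
  have hind : IndepFun (fun ω => ((X ω).re : ℂ)) (fun ω => ((X ω).im : ℂ) * Complex.I) P :=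
    h.indep.comp (φ := fun x : ℝ => (x : ℂ)) (ψ := fun x : ℝ => (x : ℂ) * Complex.I)
      (by fun_prop) (by fun_prop)
  have key : ∀ (Y : Ω → ℝ) (w : ℂ), HasLaw Y (gaussianReal 0 (v / 2)) P →
      charFun (P.map fun ω => (Y ω : ℂ) * w) t =
        Complex.exp (-(v * (inner ℝ w t) ^ 2 / 4 : ℝ)) := by
    intro Y w hY
    have hYm := hY.aemeasurable
    have : charFun (P.map fun ω => (Y ω : ℂ) * w) t =
        charFun (P.map Y) (inner ℝ w t) := by
      rw [charFun_apply, charFun_apply_real, integral_map (by fun_prop) (by fun_prop),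
        integral_map (by fun_prop) (by fun_prop)]
      congr 1 with ω
      rw [show (Y ω : ℂ) * w = Y ω • w from rfl, real_inner_smul_left]
      push_cast
      ring_nf
    rw [this, hY.map_eq, charFun_gaussianReal]
    congr 1
    push_cast
    ring
  conv_lhs => rw [hX]
  rw [hind.charFun_map_add_eq_mul (by fun_prop) (by fun_prop), Pi.mul_apply]
  have e1 := key _ 1 h.law_re
  simp only [mul_one] at e1
  rw [e1, key _ Complex.I h.law_im, ← Complex.exp_add]
  congr 1
  rw [Complex.sq_norm, Complex.normSq_apply]
  simp [Complex.inner]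
  ring

theorem iIndepFun.charFun_map_sum_mul_pow [IsProbabilityMeasure P] {a : ℕ → Ω → ℂ} {σ : ℕ → ℝ≥0}
    (hnormal : ∀ i, IsComplexNormal (a i) (σ i ^ 2) P) (hindep : iIndepFun a P) (z t : ℂ) (n : ℕ) :
    charFun (P.map fun ω => ∑ i ∈ Finset.range n, a i ω * z ^ i) t =
      Complex.exp (-((∑ i ∈ Finset.range n, (σ i : ℝ) ^ 2 * (‖z‖ ^ 2) ^ i) * ‖t‖ ^ 2 / 4 : ℝ)) := by
  have hm := fun i => (hnormal i).aemeasurable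
  have hind : iIndepFun (fun i ω => a i ω * z ^ i) P :=
    hindep.comp (fun i x => x * z ^ i) fun i => by fun_prop
  rw [(hind.restrict _).charFun_map_fun_finsetSum_eq_prod fun i _ => by fun_prop,
    Finset.prod_apply]
  have : ∀ i, charFun (P.map fun ω => a i ω * z ^ i) t =
      Complex.exp (-((σ i : ℝ) ^ 2 * (‖z‖ ^ 2) ^ i * ‖t‖ ^ 2 / 4 : ℝ)) := by
    intro i
    -- The real adjoint of multiplication by `z ^ i` is multiplication by its conjugate.
    have : charFun (P.map fun ω => a i ω * z ^ i) t =
        charFun (P.map (a i)) (t * (starRingEnd ℂ) (z ^ i)) := by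
      rw [charFun_apply, charFun_apply, integral_map (by fun_prop) (by fun_prop),
        integral_map (by fun_prop) (by fun_prop)]
      congr 1 with ω
      congr 3
      simp only [Complex.inner, map_mul]
      ring_nf
    rw [this, (hnormal i).charFun_map]
    congr 1
    rw [norm_mul, RCLike.norm_conj, norm_pow]
    push_cast
    ring
  simp_rw [this, ← Complex.exp_sum]
  congr 1
  push_cast
  rw [Finset.sum_mul, Finset.sum_div, ← Finset.sum_neg_distrib]

-- The partial sums converge almost surely, hence their characteristic functions converge by
-- dominated convergence; the limit identifies the law.
open Filter Topology in
theorem hasLaw_randomSeries [IsProbabilityMeasure P] {a : ℕ → Ω → ℂ} {σ : ℕ → ℝ≥0}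
    (hnormal : ∀ i, IsComplexNormal (a i) (σ i ^ 2) P) (hindep : iIndepFun a P) {z : ℂ}
    (hsum : ∀ᵐ ω ∂P, Summable fun i => a i ω * z ^ i)
    (hσ : Summable fun i => (σ i : ℝ) ^ 2 * (‖z‖ ^ 2) ^ i) :
    HasLaw (fun ω => randomSeries a ω z)
      ((stdGaussian ℂ).map (fun x => √(varianceGF σ (‖z‖ ^ 2) / 2) • x)) P := by
  have hm := fun i => (hnormal i).aemeasurable
  have hlim : ∀ᵐ ω ∂P, Tendsto (fun n => ∑ i ∈ Finset.range n, a i ω * z ^ i) atTop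
      (𝓝 (randomSeries a ω z)) := by
    filter_upwards [hsum] with ω h using h.hasSum.tendsto_sum_nat
  have hmS : ∀ n, AEMeasurable (fun ω => ∑ i ∈ Finset.range n, a i ω * z ^ i) P :=
    fun n => Finset.aemeasurable_fun_sum _ fun i _ => by fun_prop
  have hmf : AEMeasurable (fun ω => randomSeries a ω z) P :=
    aemeasurable_of_tendsto_metrizable_ae' hmS hlim
  refine hasLaw_smul_stdGaussian (tsum_nonneg fun i => by positivity) hmf fun t => ?_
  refine tendsto_nhds_unique (f := fun n : ℕ =>
    charFun (P.map fun ω => ∑ i ∈ Finset.range n, a i ω * z ^ i) t) (l := atTop) ?_ ?_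
  · simp_rw [charFun_apply]
    rw [integral_map hmf (by fun_prop)]
    simp_rw [fun n => integral_map (hmS n) (f := fun x => Complex.exp ((inner ℝ x t : ℝ) * Complex.I))
      (by fun_prop)]
    refine tendsto_integral_of_dominated_convergence (fun _ => 1) (fun n => ?_)
      (integrable_const _) (fun n => ?_) ?_
    · have := hmS n
      exact AEMeasurable.aestronglyMeasurable (by fun_prop)
    · exact Eventually.of_forall fun ω => (Complex.norm_exp_ofReal_mul_I _).le
    · filter_upwards [hlim] with ω h
      exact ((by fun_prop : Continuous fun x : ℂ =>
        Complex.exp ((inner ℝ x t : ℝ) * Complex.I)).tendsto _).comp h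
  · simp_rw [iIndepFun.charFun_map_sum_mul_pow hnormal hindep]
    have h := hσ.hasSum.tendsto_sum_nat
    refine ((by fun_prop : Continuous fun x : ℝ =>
        Complex.exp (-(x * ‖t‖ ^ 2 / 4 : ℝ))).tendsto _).comp h

variable {X : Ω → ℂ} {v : ℝ}

theorem ae_ne_zero_of_hasLaw_smul_stdGaussian (hv : 0 < v)
    (hX : HasLaw X ((stdGaussian ℂ).map (fun x => √(v / 2) • x)) P) : ∀ᵐ ω ∂P, X ω ≠ 0 := by
  have : ∀ᵐ y ∂(P.map X), y ≠ 0 := by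
    rw [hX.map_eq, ae_map_iff (by fun_prop) (by measurability)]
    filter_upwards [ae_re_ne_zero_stdGaussian] with x hx
    have : √(v / 2) ≠ 0 := by positivity
    refine smul_ne_zero this ?_
    rintro rfl
    simp at hx
  exact ae_of_ae_map hX.aemeasurable this

theorem integral_comp_norm_of_hasLaw_smul_stdGaussian {g : ℝ → ℝ} (hg : Measurable g)
    (hX : HasLaw X ((stdGaussian ℂ).map (fun x => √(v / 2) • x)) P) :
    ∫ ω, g ‖X ω‖ ∂P = ∫ x : ℂ, g (√(v / 2) * ‖x‖) ∂(stdGaussian ℂ) := by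
  have hm := hX.aemeasurable
  have := integral_map (μ := P) hm (f := fun x : ℂ => g ‖x‖)
    (hg.comp measurable_norm).aestronglyMeasurable
  rw [← this, hX.map_eq, integral_map (f := fun x : ℂ => g ‖x‖) (by fun_prop)
    (hg.comp measurable_norm).aestronglyMeasurable]
  simp_rw [norm_smul, Real.norm_of_nonneg (Real.sqrt_nonneg _)]

theorem integrable_norm_of_hasLaw_smul_stdGaussian
    (hX : HasLaw X ((stdGaussian ℂ).map (fun x => √(v / 2) • x)) P) :
    Integrable X P := by
  have h : Integrable id (P.map X) := by
    rw [hX.map_eq, integrable_map_measure (by fun_prop) (by fun_prop)]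
    exact (IsGaussian.integrable_id (μ := stdGaussian ℂ)).smul (√(v / 2))
  exact (integrable_map_measure (by fun_prop) hX.aemeasurable).1 h

theorem log_norm_smul_ae_eq (hv : 0 < v) :
    (fun x : ℂ => Real.log (√(v / 2) * ‖x‖)) =ᵐ[stdGaussian ℂ]
      fun x => (Real.log v - Real.log 2) / 2 + Real.log ‖x‖ := by
  filter_upwards [ae_re_ne_zero_stdGaussian] with x hx
  have h0 : ‖x‖ ≠ 0 := by
    rw [norm_ne_zero_iff]; rintro rfl; simp at hx
  rw [Real.log_mul (by positivity) h0, Real.log_sqrt (by positivity),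
    Real.log_div hv.ne' two_ne_zero]

theorem integrable_log_norm_of_hasLaw_smul_stdGaussian (hv : 0 < v)
    (hX : HasLaw X ((stdGaussian ℂ).map (fun x => √(v / 2) • x)) P) :
    Integrable (fun ω => Real.log ‖X ω‖) P := by
  have h : Integrable (fun x : ℂ => Real.log ‖x‖) (P.map X) := by
    rw [hX.map_eq,
      integrable_map_measure measurable_log_norm.aestronglyMeasurable (by fun_prop)]
    refine (((integrable_const ((Real.log v - Real.log 2) / 2)).add
      integrable_log_norm_stdGaussian).congr (log_norm_smul_ae_eq hv).symm).congr ?_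
    refine Filter.Eventually.of_forall fun x => ?_
    simp [abs_of_nonneg (Real.sqrt_nonneg _)]
  exact (integrable_map_measure measurable_log_norm.aestronglyMeasurable hX.aemeasurable).1 h

/-- Scaling turns into an additive `log v / 2`; the remaining constant does not depend on `v` and is
never evaluated. -/
theorem integral_log_norm_of_hasLaw_smul_stdGaussian (hv : 0 < v)
    (hX : HasLaw X ((stdGaussian ℂ).map (fun x => √(v / 2) • x)) P) :
    ∫ ω, Real.log ‖X ω‖ ∂P =
      Real.log v / 2 + (∫ x : ℂ, Real.log ‖x‖ ∂(stdGaussian ℂ) - Real.log 2 / 2) := by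
  rw [integral_comp_norm_of_hasLaw_smul_stdGaussian Real.measurable_log hX,
    integral_congr_ae (log_norm_smul_ae_eq hv),
    integral_add (integrable_const _) integrable_log_norm_stdGaussian]
  simp
  ring

end

/-! ### The generating function of the variances -/

theorem exists_gt_ofReal_sq_lt {R : ℝ≥0∞} {t : ℝ} (ht : ENNReal.ofReal (t ^ 2) < R) :
    ∃ q : ℝ, t < q ∧ ENNReal.ofReal (q ^ 2) < R := by
  have hc : Filter.Tendsto (fun q : ℝ => ENNReal.ofReal (q ^ 2)) (nhdsWithin t (Set.Ioi t))
      (nhds (ENNReal.ofReal (t ^ 2))) :=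
    ((ENNReal.continuous_ofReal.comp (continuous_pow 2)).tendsto t).mono_left nhdsWithin_le_nhds
  obtain ⟨q, hq, hq'⟩ := ((hc.eventually_lt_const ht).and self_mem_nhdsWithin).exists
  exact ⟨q, hq', hq⟩

theorem hasFPowerSeriesOnBall_varianceGF {σ : ℕ → ℝ≥0} (h : 0 < varianceRadius σ) :
    HasFPowerSeriesOnBall (varianceGF σ)
      (FormalMultilinearSeries.ofScalars ℝ fun i => (σ i : ℝ) ^ 2) 0 (varianceRadius σ) := by
  have := (FormalMultilinearSeries.ofScalars ℝ fun i => (σ i : ℝ) ^ 2).hasFPowerSeriesOnBall h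
  refine this.congr fun x _ => ?_
  have := congrFun (FormalMultilinearSeries.ofScalarsSum_eq_tsum (𝕜 := ℝ) (E := ℝ)
    (fun i => (σ i : ℝ) ^ 2)) x
  simpa [varianceGF, FormalMultilinearSeries.ofScalarsSum] using this

section

variable {σ : ℕ → ℝ≥0} {t : ℝ}

theorem exists_bound_mul_pow_of_lt_varianceRadius (ht : ENNReal.ofReal (t ^ 2) < varianceRadius σ) :
    ∃ C, ∀ i, (σ i : ℝ) ^ 2 * (t ^ 2) ^ i ≤ C := by
  obtain ⟨C, -, hC⟩ := FormalMultilinearSeries.norm_mul_pow_le_of_lt_radius _ ht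
  refine ⟨C, fun i => ?_⟩
  have := hC i
  rwa [FormalMultilinearSeries.ofScalars_norm, Real.norm_of_nonneg (by positivity),
    Real.coe_toNNReal _ (by positivity)] at this

/-- At a slightly larger radius `q` the terms `σ i * q ^ i` are bounded, so the series is dominated
by a geometric one of ratio `t / q`. -/
theorem summable_mul_pow_of_lt_varianceRadius (ht0 : 0 ≤ t)
    (ht : ENNReal.ofReal (t ^ 2) < varianceRadius σ) : Summable fun i => (σ i : ℝ) * t ^ i := by
  obtain ⟨q, hq, hqR⟩ := exists_gt_ofReal_sq_lt ht
  obtain ⟨C, hC⟩ := exists_bound_mul_pow_of_lt_varianceRadius hqR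
  have hq0 : 0 < q := ht0.trans_lt hq
  refine Summable.of_nonneg_of_le (fun i => by positivity) (fun i => ?_)
    ((summable_geometric_of_lt_one (r := t / q) (by positivity)
      ((div_lt_one hq0).2 hq)).mul_left √C)
  have h : (σ i : ℝ) * q ^ i ≤ √C := by
    refine Real.le_sqrt_of_sq_le ?_
    rw [mul_pow, ← pow_mul, mul_comm i, pow_mul]
    exact hC i
  calc (σ i : ℝ) * t ^ i = σ i * q ^ i * (t / q) ^ i := by
        rw [div_pow]; field_simp
    _ ≤ √C * (t / q) ^ i := by gcongr

theorem summable_sq_mul_pow_of_lt_varianceRadius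
    (ht : ENNReal.ofReal (t ^ 2) < varianceRadius σ) :
    Summable fun i => (σ i : ℝ) ^ 2 * (t ^ 2) ^ i := by
  have h := (FormalMultilinearSeries.ofScalars ℝ fun i => (σ i : ℝ) ^ 2).summable_norm_mul_pow
    (r := (t ^ 2).toNNReal) ht
  refine h.congr fun i => ?_
  rw [FormalMultilinearSeries.ofScalars_norm, Real.norm_of_nonneg (by positivity),
    Real.coe_toNNReal _ (by positivity)]

theorem varianceGF_pos (hσ : ∃ i, σ i ≠ 0) (ht0 : 0 < t)
    (ht : ENNReal.ofReal (t ^ 2) < varianceRadius σ) : 0 < varianceGF σ (t ^ 2) := by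
  obtain ⟨i, hi⟩ := hσ
  have : 0 < σ i := pos_iff_ne_zero.2 hi
  exact (summable_sq_mul_pow_of_lt_varianceRadius ht).tsum_pos (fun i => by positivity) i
    (by positivity)

theorem differentiableAt_log_varianceGF_sq (hσ : ∃ i, σ i ≠ 0) (ht0 : 0 < t)
    (ht : ENNReal.ofReal (t ^ 2) < varianceRadius σ) :
    DifferentiableAt ℝ (fun s : ℝ => Real.log (varianceGF σ (s ^ 2))) t := by
  have h := hasFPowerSeriesOnBall_varianceGF (pos_of_gt ht)
  have hmem : t ^ 2 ∈ Metric.eball (0 : ℝ) (varianceRadius σ) := by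
    rw [Metric.mem_eball, edist_zero_right, ← ofReal_norm, Real.norm_of_nonneg (by positivity)]
    exact ht
  have hd : DifferentiableAt ℝ (varianceGF σ) (t ^ 2) :=
    (h.analyticAt_of_mem hmem).differentiableAt
  have : DifferentiableAt ℝ (fun s : ℝ => varianceGF σ (s ^ 2)) t :=
    DifferentiableAt.comp (f := fun s : ℝ => s ^ 2) t hd (by fun_prop)
  exact this.log (varianceGF_pos hσ ht0 ht).ne'

theorem varianceGF_sq_le {s : ℝ} (hs : 0 ≤ s) (hst : s ≤ t)
    (ht : ENNReal.ofReal (t ^ 2) < varianceRadius σ) :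
    varianceGF σ (s ^ 2) ≤ varianceGF σ (t ^ 2) :=
  Summable.tsum_le_tsum (fun i => by gcongr)
    (summable_sq_mul_pow_of_lt_varianceRadius
      ((ENNReal.ofReal_le_ofReal (by gcongr)).trans_lt ht))
    (summable_sq_mul_pow_of_lt_varianceRadius ht)

open Filter Topology in
theorem deriv_log_varianceGF_sq_nonneg (hσ : ∃ i, σ i ≠ 0) (ht0 : 0 < t)
    (ht : ENNReal.ofReal (t ^ 2) < varianceRadius σ) :
    0 ≤ deriv (fun s : ℝ => Real.log (varianceGF σ (s ^ 2))) t := by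
  have hlim := (differentiableAt_log_varianceGF_sq hσ ht0 ht).hasDerivAt.tendsto_slope.mono_left
    (nhdsWithin_mono t fun s (hs : s ∈ Set.Iio t) => ne_of_lt hs)
  refine ge_of_tendsto hlim ?_
  filter_upwards [Ioo_mem_nhdsLT ht0] with s hs
  have hpos := varianceGF_pos hσ hs.1 ((ENNReal.ofReal_le_ofReal (by
    have := hs.1.le; have := hs.2.le; gcongr)).trans_lt ht)
  rw [slope_comm, slope_def_field]
  exact div_nonneg (sub_nonneg.2 (Real.log_le_log hpos (varianceGF_sq_le hs.1.le hs.2.le ht)))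
    (sub_nonneg.2 hs.2.le)

end

/-! ### The random series: convergence, circle averages, Jensen bounds -/

section

theorem analyticOnNhd_randomSeries {Ω : Type*} {a : ℕ → Ω → ℂ} {ω : Ω} {q : ℝ}
    (hsum : Summable fun i => ‖a i ω‖ * q ^ i) :
    AnalyticOnNhd ℂ (randomSeries a ω) (Metric.ball 0 q) := by
  refine DifferentiableOn.analyticOnNhd ?_ Metric.isOpen_ball
  refine Complex.differentiableOn_tsum_of_summable_norm hsum (fun i => by fun_prop)
    Metric.isOpen_ball fun i z hz => ?_
  rw [norm_mul, norm_pow]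
  have := (mem_ball_zero_iff.1 hz).le
  gcongr

variable {Ω : Type*} [MeasurableSpace Ω] {P : Measure Ω} [IsProbabilityMeasure P]
  {a : ℕ → Ω → ℂ} {σ : ℕ → ℝ≥0}

theorem IsComplexNormal.hasLaw {X : Ω → ℂ} {v : ℝ≥0} (h : IsComplexNormal X v P) :
    HasLaw X ((stdGaussian ℂ).map (fun x => √((v : ℝ) / 2) • x)) P :=
  hasLaw_smul_stdGaussian v.2 h.aemeasurable h.charFun_map

/-- `E‖a i‖` is a constant times `σ i`, so by Tonelli the sum of norms has finite expectation. -/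
theorem ae_summable_norm_mul_pow (hnormal : ∀ i, IsComplexNormal (a i) (σ i ^ 2) P) {t : ℝ}
    (ht0 : 0 ≤ t) (ht : ENNReal.ofReal (t ^ 2) < varianceRadius σ) :
    ∀ᵐ ω ∂P, Summable fun i => ‖a i ω‖ * t ^ i := by
  have hm := fun i => (hnormal i).aemeasurable
  have hint := fun i => integrable_norm_of_hasLaw_smul_stdGaussian (hnormal i).hasLaw
  have hnorm : ∀ i, ∫ ω, ‖a i ω‖ * t ^ i ∂P =
      (∫ x : ℂ, ‖x‖ ∂(stdGaussian ℂ)) / √2 * (σ i * t ^ i) := by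
    intro i
    have := integral_comp_norm_of_hasLaw_smul_stdGaussian measurable_id (hnormal i).hasLaw
    simp only [id] at this
    rw [integral_mul_const, this, integral_const_mul, NNReal.coe_pow, Real.sqrt_div (by positivity),
      Real.sqrt_sq (by positivity)]
    ring
  have hlin : ∫⁻ ω, ∑' i, ENNReal.ofReal (‖a i ω‖ * t ^ i) ∂P ≠ ⊤ := by
    rw [lintegral_tsum fun i => by fun_prop]
    have : ∀ i, ∫⁻ ω, ENNReal.ofReal (‖a i ω‖ * t ^ i) ∂P = ENNReal.ofReal
        ((∫ x : ℂ, ‖x‖ ∂(stdGaussian ℂ)) / √2 * (σ i * t ^ i)) := by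
      intro i
      rw [← hnorm, ofReal_integral_eq_lintegral_ofReal ((hint i).norm.mul_const _)
        (Filter.Eventually.of_forall fun ω => by positivity)]
    simp_rw [this]
    exact ((summable_mul_pow_of_lt_varianceRadius ht0 ht).mul_left _).tsum_ofReal_ne_top
  filter_upwards [ae_lt_top' (AEMeasurable.tsum fun i => by fun_prop) hlin] with ω hω
  refine (ENNReal.summable_toReal hω.ne).congr fun i => ?_
  exact ENNReal.toReal_ofReal (by positivity)

/-- Comparison with a larger rational radius reduces uncountably many null sets to countably many.
-/
theorem ae_forall_summable (hnormal : ∀ i, IsComplexNormal (a i) (σ i ^ 2) P) :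
    ∀ᵐ ω ∂P, ∀ t : ℝ, 0 ≤ t → ENNReal.ofReal (t ^ 2) < varianceRadius σ →
      Summable fun i => ‖a i ω‖ * t ^ i := by
  have : ∀ᵐ ω ∂P, ∀ q : ℚ, 0 ≤ (q : ℝ) → ENNReal.ofReal ((q : ℝ) ^ 2) < varianceRadius σ →
      Summable fun i => ‖a i ω‖ * (q : ℝ) ^ i := by
    rw [ae_all_iff]
    intro q
    by_cases h : 0 ≤ (q : ℝ) ∧ ENNReal.ofReal ((q : ℝ) ^ 2) < varianceRadius σ
    · filter_upwards [ae_summable_norm_mul_pow hnormal h.1 h.2] with ω hω _ _ using hω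
    · exact Filter.Eventually.of_forall fun ω h1 h2 => absurd ⟨h1, h2⟩ h
  filter_upwards [this] with ω hω t ht0 ht
  obtain ⟨q, hq, hqR⟩ := exists_gt_ofReal_sq_lt ht
  obtain ⟨p, hp, hpq⟩ := exists_rat_btwn hq
  have hp0 := ht0.trans hp.le
  refine (hω p hp0 (lt_of_le_of_lt (ENNReal.ofReal_le_ofReal ?_) hqR)).of_nonneg_of_le
    (fun i => by positivity) fun i => ?_
  · gcongr
  · gcongr

theorem summable_of_summable_norm_mul {c : ℕ → ℂ} {z : ℂ}
    (h : Summable fun i => ‖c i‖ * ‖z‖ ^ i) : Summable fun i => c i * z ^ i :=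
  Summable.of_norm (h.congr fun i => by rw [norm_mul, norm_pow])

theorem hasLaw_randomSeries_of_lt (hnormal : ∀ i, IsComplexNormal (a i) (σ i ^ 2) P)
    (hindep : iIndepFun a P) {z : ℂ} (hz : ENNReal.ofReal (‖z‖ ^ 2) < varianceRadius σ) :
    HasLaw (fun ω => randomSeries a ω z)
      ((stdGaussian ℂ).map (fun x => √(varianceGF σ (‖z‖ ^ 2) / 2) • x)) P := by
  refine hasLaw_randomSeries hnormal hindep ?_ (summable_sq_mul_pow_of_lt_varianceRadius hz)
  filter_upwards [ae_summable_norm_mul_pow hnormal (norm_nonneg z) hz] with ω h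
  exact summable_of_summable_norm_mul h

open Filter Topology in
theorem aemeasurable_randomSeries_circleMap (hnormal : ∀ i, IsComplexNormal (a i) (σ i ^ 2) P)
    {t : ℝ} (ht0 : 0 ≤ t) (ht : ENNReal.ofReal (t ^ 2) < varianceRadius σ) (μ : Measure ℝ)
    [SFinite μ] :
    AEMeasurable (fun p : Ω × ℝ => randomSeries a p.1 (circleMap 0 t p.2)) (P.prod μ) := by
  have hm := fun i => (hnormal i).aemeasurable
  refine aemeasurable_of_tendsto_metrizable_ae' (f := fun (n : ℕ) (p : Ω × ℝ) =>
    ∑ i ∈ Finset.range n, a i p.1 * (circleMap 0 t p.2) ^ i) (fun n => ?_) ?_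
  · refine Finset.aemeasurable_fun_sum _ fun i _ => ((hm i).comp_fst).mul ?_
    exact (((continuous_circleMap 0 t).measurable.comp measurable_snd).pow_const i).aemeasurable
  · have := Measure.quasiMeasurePreserving_fst (μ := P) (ν := μ)
    filter_upwards [this.ae (ae_summable_norm_mul_pow hnormal ht0 ht)] with p hp
    refine (summable_of_summable_norm_mul ?_).hasSum.tendsto_sum_nat
    simpa [abs_of_nonneg ht0] using hp

/-- The law of the series at `z` depends only on `‖z‖`, so after Fubini the inner expectation is
constant along the circle. -/
theorem integrable_and_integral_circleAverage_log_norm_randomSeries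
    (hσ : ∃ i, σ i ≠ 0) (hnormal : ∀ i, IsComplexNormal (a i) (σ i ^ 2) P)
    (hindep : iIndepFun a P) {t : ℝ} (ht0 : 0 < t) (ht : ENNReal.ofReal (t ^ 2) < varianceRadius σ) :
    Integrable (fun ω => Real.circleAverage (fun z => Real.log ‖randomSeries a ω z‖) 0 t) P ∧
      ∫ ω, Real.circleAverage (fun z => Real.log ‖randomSeries a ω z‖) 0 t ∂P =
        Real.log (varianceGF σ (t ^ 2)) / 2 +
          (∫ x : ℂ, Real.log ‖x‖ ∂(stdGaussian ℂ) - Real.log 2 / 2) := by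
  have hv := varianceGF_pos hσ ht0 ht
  have hlaw : ∀ θ : ℝ, HasLaw (fun ω => randomSeries a ω (circleMap 0 t θ))
      ((stdGaussian ℂ).map (fun x => √(varianceGF σ (t ^ 2) / 2) • x)) P := by
    intro θ
    have hn : ‖circleMap 0 t θ‖ = t := by simp [abs_of_pos ht0]
    have := hasLaw_randomSeries_of_lt hnormal hindep (z := circleMap 0 t θ) (by rwa [hn])
    rwa [hn] at this
  set μ : Measure ℝ := volume.restrict (Set.Ioc 0 (2 * Real.pi)) with hμ
  have hint : Integrable (fun p : Ω × ℝ => Real.log ‖randomSeries a p.1 (circleMap 0 t p.2)‖)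
      (P.prod μ) := by
    have hm : AEMeasurable (fun p : Ω × ℝ =>
        Real.log ‖randomSeries a p.1 (circleMap 0 t p.2)‖) (P.prod μ) :=
      measurable_log_norm.comp_aemeasurable
        (aemeasurable_randomSeries_circleMap hnormal ht0.le ht μ)
    rw [integrable_prod_iff' hm.aestronglyMeasurable]
    refine ⟨Filter.Eventually.of_forall fun θ =>
      integrable_log_norm_of_hasLaw_smul_stdGaussian hv (hlaw θ), ?_⟩
    have : ∀ θ : ℝ, ∫ ω, ‖Real.log ‖randomSeries a ω (circleMap 0 t θ)‖‖ ∂P =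
        ∫ x : ℂ, ‖Real.log (√(varianceGF σ (t ^ 2) / 2) * ‖x‖)‖ ∂(stdGaussian ℂ) :=
      fun θ => integral_comp_norm_of_hasLaw_smul_stdGaussian (g := fun x => ‖Real.log x‖)
        Real.measurable_log.norm (hlaw θ)
    simp_rw [this]
    exact integrable_const _
  have havg : ∀ ω, Real.circleAverage (fun z => Real.log ‖randomSeries a ω z‖) 0 t =
      (2 * Real.pi)⁻¹ * ∫ θ, Real.log ‖randomSeries a ω (circleMap 0 t θ)‖ ∂μ := by
    intro ω
    rw [Real.circleAverage_def, intervalIntegral.integral_of_le (by positivity), smul_eq_mul]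
  simp_rw [havg]
  refine ⟨hint.integral_prod_left.const_mul _, ?_⟩
  rw [integral_const_mul, integral_integral_swap hint]
  simp_rw [fun θ => integral_log_norm_of_hasLaw_smul_stdGaussian hv (hlaw θ)]
  have hpi := Real.pi_pos
  rw [integral_const, smul_eq_mul, hμ]
  simp only [measureReal_restrict_apply_univ, Real.volume_real_Ioc, sub_zero]
  rw [max_eq_left (by positivity), ← mul_assoc, inv_mul_cancel₀ (by positivity), one_mul]

theorem ae_zeroCount_sandwich
    (hσ : ∃ i, σ i ≠ 0) (hnormal : ∀ i, IsComplexNormal (a i) (σ i ^ 2) P)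
    (hindep : iIndepFun a P) {s t : ℝ} (hs : 0 < s) (hst : s < t) (ht : ENNReal.ofReal (t ^ 2) < varianceRadius σ) :
    ∀ᵐ ω ∂P, zeroCount (randomSeries a ω) (Metric.ball 0 s) *
          ENNReal.ofReal (Real.log (t / s)) ≤
        ENNReal.ofReal (Real.circleAverage (fun z => Real.log ‖randomSeries a ω z‖) 0 t -
          Real.circleAverage (fun z => Real.log ‖randomSeries a ω z‖) 0 s) ∧
      ENNReal.ofReal (Real.circleAverage (fun z => Real.log ‖randomSeries a ω z‖) 0 t -
          Real.circleAverage (fun z => Real.log ‖randomSeries a ω z‖) 0 s) ≤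
        zeroCount (randomSeries a ω) (Metric.ball 0 t) * ENNReal.ofReal (Real.log (t / s)) ∧
      0 ≤ Real.circleAverage (fun z => Real.log ‖randomSeries a ω z‖) 0 t -
          Real.circleAverage (fun z => Real.log ‖randomSeries a ω z‖) 0 s := by
  have ht0 := hs.trans hst
  obtain ⟨q, hq, hqR⟩ := exists_gt_ofReal_sq_lt ht
  -- Almost sure nonvanishing at the single point `t` rules out infinite order anywhere on the
  -- connected closed disk.
  have hn : ‖(t : ℂ)‖ = t := by simp [abs_of_pos ht0]
  have hlaw := hasLaw_randomSeries_of_lt hnormal hindep (z := (t : ℂ)) (by rwa [hn])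
  rw [hn] at hlaw
  filter_upwards [ae_summable_norm_mul_pow hnormal (ht0.trans hq).le hqR,
    ae_ne_zero_of_hasLaw_smul_stdGaussian (varianceGF_pos hσ ht0 ht) hlaw] with ω hω hne
  have han : AnalyticOnNhd ℂ (randomSeries a ω) (Metric.closedBall 0 t) :=
    (analyticOnNhd_randomSeries hω).mono (Metric.closedBall_subset_ball hq)
  have hmem : (t : ℂ) ∈ Metric.closedBall (0 : ℂ) t := by simp [abs_of_pos ht0]
  refine zeroCount_mul_log_le_and_le hs hst han fun u hu => ?_
  refine han.analyticOrderAt_ne_top_of_isPreconnected (convex_closedBall 0 t).isPreconnected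
    hmem hu ?_
  rw [(analyticOrderAt_eq_zero).2 (Or.inr hne)]
  simp

end

/-! ### Expectation and measurability of the zero count -/

open Filter Topology in
theorem lintegral_eq_of_forall_mul_log_le {Ω : Type*} [MeasurableSpace Ω] {P : Measure Ω}
    {N : ℝ → Ω → ℝ≥0∞} {D : ℝ → ℝ → Ω → ℝ≥0∞} {G : ℝ → ℝ} {g r q : ℝ} (hr : 0 < r) (hrq : r < q)
    (hle : ∀ s t, 0 < s → s < t → t < q →
      ∀ᵐ ω ∂P, N s ω * ENNReal.ofReal (Real.log (t / s)) ≤ D s t ω)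
    (hge : ∀ s t, 0 < s → s < t → t < q →
      ∀ᵐ ω ∂P, D s t ω ≤ N t ω * ENNReal.ofReal (Real.log (t / s)))
    (hD : ∀ s t, 0 < s → s < t → t < q → ∫⁻ ω, D s t ω ∂P = ENNReal.ofReal (G t - G s))
    (hG : HasDerivAt G g r) : ∫⁻ ω, N r ω ∂P = ENNReal.ofReal (r * g) := by
  have hlim : Tendsto (fun s => ENNReal.ofReal (slope G r s / slope Real.log r s)) (𝓝[≠] r)
      (𝓝 (ENNReal.ofReal (r * g))) := by
    -- The increment of `G` over that of `log` is a quotient of slopes, with limit `g / r⁻¹`.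
    have := hG.tendsto_slope.div (Real.hasDerivAt_log hr.ne').tendsto_slope (inv_ne_zero hr.ne')
    rw [div_inv_eq_mul, mul_comm] at this
    exact (ENNReal.continuous_ofReal.tendsto _).comp this
  have hslope : ∀ s t, 0 < s → s < t → ENNReal.ofReal (G t - G s) =
      ENNReal.ofReal (slope G s t / slope Real.log s t) * ENNReal.ofReal (Real.log (t / s)) := by
    intro s t hs hst
    have h0 : 0 < Real.log t - Real.log s := sub_pos.2 (Real.log_lt_log hs hst)
    rw [Real.log_div (hs.trans hst).ne' hs.ne', ← ENNReal.ofReal_mul' h0.le, slope_def_field,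
      slope_def_field]
    have : t - s ≠ 0 := (sub_pos.2 hst).ne'
    congr 1
    field_simp
  have hpos : ∀ s t, 0 < s → s < t → ENNReal.ofReal (Real.log (t / s)) ≠ 0 := by
    intro s t hs hst
    exact (ENNReal.ofReal_pos.2 (Real.log_pos ((one_lt_div hs).2 hst))).ne'
  apply le_antisymm
  · refine ge_of_tendsto (hlim.mono_left (nhdsWithin_mono r fun s (hs : s ∈ Set.Ioi r) => ne_of_gt hs)) ?_
    filter_upwards [Ioo_mem_nhdsGT hrq] with t ht
    have h := lintegral_mono_ae (hle r t hr ht.1 ht.2)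
    rw [hD r t hr ht.1 ht.2, hslope r t hr ht.1, lintegral_mul_const' _ _ ENNReal.ofReal_ne_top] at h
    exact (ENNReal.mul_le_mul_iff_left (hpos r t hr ht.1) ENNReal.ofReal_ne_top).1 h
  · refine le_of_tendsto (hlim.mono_left (nhdsWithin_mono r fun s (hs : s ∈ Set.Iio r) => ne_of_lt hs)) ?_
    filter_upwards [Ioo_mem_nhdsLT hr] with s hs
    have h := lintegral_mono_ae (hge s r hs.1 hs.2 hrq)
    rw [hD s r hs.1 hs.2 hrq, hslope s r hs.1 hs.2, lintegral_mul_const' _ _ ENNReal.ofReal_ne_top,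
      slope_comm G, slope_comm Real.log] at h
    exact (ENNReal.mul_le_mul_iff_left (hpos s r hs.1 hs.2) ENNReal.ofReal_ne_top).1 h

-- Along `s k ↑ r`, the Jensen quotients lie between the counts in the disks of radius `s k` and
-- `r`, so almost surely their supremum is the count, and they are measurable.
open Filter Topology in
theorem aemeasurable_zeroCount_randomSeries {Ω : Type*} [MeasurableSpace Ω] {P : Measure Ω}
    [IsProbabilityMeasure P] {a : ℕ → Ω → ℂ} {σ : ℕ → ℝ≥0}
    (hnormal : ∀ i, IsComplexNormal (a i) (σ i ^ 2) P) (hindep : iIndepFun a P)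
    (hσ : ∃ i, σ i ≠ 0) {r : ℝ} (hr : 0 < r) (hrR : ENNReal.ofReal (r ^ 2) < varianceRadius σ) :
    AEMeasurable (fun ω => zeroCount (randomSeries a ω) (Metric.ball 0 r)) P := by
  obtain ⟨s, hmono, hsr, hlim⟩ := exists_seq_strictMono_tendsto' hr
  set A : ℝ → Ω → ℝ :=
    fun t ω => Real.circleAverage (fun z => Real.log ‖randomSeries a ω z‖) 0 t with hA
  have hmeas : ∀ t, 0 < t → t ≤ r → AEMeasurable (A t) P := fun t ht htr =>
    (integrable_and_integral_circleAverage_log_norm_randomSeries hσ hnormal hindep ht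
      ((ENNReal.ofReal_le_ofReal (by gcongr)).trans_lt hrR)).1.aemeasurable
  have hsup : AEMeasurable (fun ω => ⨆ k, ENNReal.ofReal (A r ω - A (s k) ω) /
      ENNReal.ofReal (Real.log (r / s k))) P :=
    AEMeasurable.iSup fun k => (((hmeas r hr le_rfl).sub
      (hmeas (s k) (hsr k).1 (hsr k).2.le)).ennreal_ofReal).div_const _
  refine hsup.congr ?_
  have hae := ae_all_iff.2 fun k => ae_zeroCount_sandwich hσ hnormal hindep (hsr k).1 (hsr k).2 hrR
  filter_upwards [hae] with ω hω
  have hpos : ∀ k, ENNReal.ofReal (Real.log (r / s k)) ≠ 0 := fun k =>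
    (ENNReal.ofReal_pos.2 (Real.log_pos ((one_lt_div (hsr k).1).2 (hsr k).2))).ne'
  refine le_antisymm (iSup_le fun k => ?_)
    ((zeroCount_ball_le_iSup _ hmono.monotone hlim).trans (iSup_mono fun k => ?_))
  · exact ENNReal.div_le_of_le_mul (hω k).2.1
  · rw [ENNReal.le_div_iff_mul_le (Or.inl (hpos k)) (Or.inl ENNReal.ofReal_ne_top)]
    exact (hω k).1

theorem lintegral_zeroCount_randomSeries {Ω : Type*} [MeasurableSpace Ω] {P : Measure Ω}
    [IsProbabilityMeasure P] {a : ℕ → Ω → ℂ} {σ : ℕ → ℝ≥0}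
    (hnormal : ∀ i, IsComplexNormal (a i) (σ i ^ 2) P) (hindep : iIndepFun a P)
    (hσ : ∃ i, σ i ≠ 0) {r : ℝ} (hr : 0 < r) (hrR : ENNReal.ofReal (r ^ 2) < varianceRadius σ) :
    ∫⁻ ω, zeroCount (randomSeries a ω) (Metric.ball 0 r) ∂P = ENNReal.ofReal
      (r * (deriv (fun s : ℝ => Real.log (varianceGF σ (s ^ 2))) r / 2)) := by
  obtain ⟨q, hq, hqR⟩ := exists_gt_ofReal_sq_lt hrR
  have hR : ∀ t, 0 < t → t < q → ENNReal.ofReal (t ^ 2) < varianceRadius σ := fun t ht htq =>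
    (ENNReal.ofReal_le_ofReal (by gcongr)).trans_lt hqR
  set A : ℝ → Ω → ℝ :=
    fun t ω => Real.circleAverage (fun z => Real.log ‖randomSeries a ω z‖) 0 t with hA
  refine lintegral_eq_of_forall_mul_log_le
    (N := fun t ω => zeroCount (randomSeries a ω) (Metric.ball 0 t))
    (D := fun s t ω => ENNReal.ofReal (A t ω - A s ω))
    (G := fun s => Real.log (varianceGF σ (s ^ 2)) / 2) hr hq ?_ ?_ ?_
    ((differentiableAt_log_varianceGF_sq hσ hr hrR).hasDerivAt.div_const 2)
  · intro s t hs hst htq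
    exact (ae_zeroCount_sandwich hσ hnormal hindep hs hst (hR t (hs.trans hst) htq)).mono
      fun ω h => h.1
  · intro s t hs hst htq
    exact (ae_zeroCount_sandwich hσ hnormal hindep hs hst (hR t (hs.trans hst) htq)).mono
      fun ω h => h.2.1
  · intro s t hs hst htq
    have h1 := integrable_and_integral_circleAverage_log_norm_randomSeries hσ hnormal hindep
      (hs.trans hst) (hR t (hs.trans hst) htq)
    have h2 := integrable_and_integral_circleAverage_log_norm_randomSeries hσ hnormal hindep
      hs (hR s hs (hst.trans htq))
    rw [← ofReal_integral_eq_lintegral_ofReal (f := fun ω => A t ω - A s ω) (h1.1.sub h2.1)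
      ((ae_zeroCount_sandwich hσ hnormal hindep hs hst (hR t (hs.trans hst) htq)).mono
        fun ω h => h.2.2), integral_sub h1.1 h2.1, h1.2, h2.2, add_sub_add_right_eq_sub]

theorem theorem8p2 {Ω : Type*} [MeasurableSpace Ω] (P : Measure Ω) [IsProbabilityMeasure P]
    (a : ℕ → Ω → ℂ) (σ : ℕ → ℝ≥0)
    (hnormal : ∀ i, IsComplexNormal (a i) (σ i ^ 2) P)
    (hindep : iIndepFun a P)
    (hσ : ∃ i, σ i ≠ 0)
    (hrad : 0 < varianceRadius σ) :
    (∀ᵐ ω ∂P, ∀ z : ℂ, ENNReal.ofReal (‖z‖ ^ 2) < varianceRadius σ →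
      Summable (fun i => a i ω * z ^ i)) ∧
    ∀ r : ℝ, 0 < r → ENNReal.ofReal (r ^ 2) < varianceRadius σ →
      AEMeasurable (fun ω => zeroCount (randomSeries a ω) (Metric.ball 0 r)) P ∧
      DifferentiableAt ℝ (fun s : ℝ => Real.log (varianceGF σ (s ^ 2))) r ∧
      ∫⁻ ω, zeroCount (randomSeries a ω) (Metric.ball 0 r) ∂P ≠ ⊤ ∧
      (∫⁻ ω, zeroCount (randomSeries a ω) (Metric.ball 0 r) ∂P).toReal =
        r / 2 * deriv (fun s : ℝ => Real.log (varianceGF σ (s ^ 2))) r := by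
  refine ⟨?_, fun r hr hrR => ⟨aemeasurable_zeroCount_randomSeries hnormal hindep hσ hr hrR,
    differentiableAt_log_varianceGF_sq hσ hr hrR, ?_⟩⟩
  · filter_upwards [ae_forall_summable hnormal] with ω hω z hz
    exact summable_of_summable_norm_mul (hω ‖z‖ (norm_nonneg z) hz)
  · rw [lintegral_zeroCount_randomSeries hnormal hindep hσ hr hrR]
    refine ⟨ENNReal.ofReal_ne_top, ?_⟩
    -- Nonnegativity ensures that `ENNReal.ofReal` does not truncate the value.
    have := deriv_log_varianceGF_sq_nonneg hσ hr hrR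
    rw [ENNReal.toReal_ofReal (by positivity), mul_div_assoc', div_mul_eq_mul_div]
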